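/- For $1\le n<p$ let $V(n,p)=\{M\in\mathbb{R}^{n\times p}: MM^{T}=I_n\}$ be the Stiefel manifold. A random matrix $V$ is uniformly distributed on $V(n,p)$ if it takes values in $V(n,p)$ almost surely and, for every fixed orthogonal matrix $O\in O(p,\mathbb{R})$, the matrices $V$ and $VO$ have the same distribution. Let $V_j\in\mathbb{R}^n$ denote the $j$-th column of $V$ and $\|\cdot\|_2$ the Euclidean norm. Theorem. There exist absolute constants $c_1,c_2>0$ and $N\in\mathbb{N}$ such that, for all integers $n\ge N$ and $p>n$ (in particular, in the regime $p\gg n$ with $n$ and $p$ large), for every random matrix $V$ uniformly distributed on $V(n,p)$, and for any two different column indices $j\ne k$: \[ \text{(1)}\quad P\Big(|V_j^{T}V_k|\ge \frac{2c_1n^{3/4}}{p}\Big)\le 6e^{-\sqrt n}, \qquad \text{(2)}\quad P\Big(\frac{|V_j^{T}V_k|}{\|V_j\|_2\,\|V_k\|_2}\ge c_2\,n^{-1/4}\Big)\le 8e^{-\sqrt n}. \] In (2) the quotient is read as $0$ if one of the two columns is zero. -/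

import Mathlib

open MeasureTheory ProbabilityTheory

/-- The Borel σ-algebra on real matrices, as the product σ-algebra of the entries. -/
instance matrixMeasurableSpace (n p : ℕ) : MeasurableSpace (Matrix (Fin n) (Fin p) ℝ) :=
  inferInstanceAs (MeasurableSpace (Fin n → Fin p → ℝ))

instance matrixBorelSpace (n p : ℕ) : BorelSpace (Matrix (Fin n) (Fin p) ℝ) :=
  inferInstanceAs (BorelSpace (Fin n → Fin p → ℝ))

/-- The Stiefel manifold `V(n, p)`: real `n × p` matrices whose rows are orthonormal. -/
def stiefel (n p : ℕ) : Set (Matrix (Fin n) (Fin p) ℝ) :=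
  {M | M * M.transpose = 1}

/-- The random matrix `V`, defined on `(Ω, P)`, is uniformly distributed on `V(n, p)`: it takes
values there almost surely, and `V` and `V O` have the same distribution for every fixed matrix
`O` of the orthogonal group `O(p, ℝ)`. Measurability of `V` is part of `IdentDistrib`. -/
structure IsUniformStiefel {Ω : Type*} [MeasurableSpace Ω] {n p : ℕ}
    (V : Ω → Matrix (Fin n) (Fin p) ℝ) (P : Measure Ω) : Prop where
  mem_stiefel : ∀ᵐ ω ∂P, V ω ∈ stiefel n p
  identDistrib_mul : ∀ O ∈ Matrix.orthogonalGroup (Fin p) ℝ,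
    IdentDistrib V (fun ω => V ω * O) P P

/-- The Euclidean norm `‖M_j‖₂` of the `j`-th column of a matrix. -/
noncomputable def colNorm {n p : ℕ} (M : Matrix (Fin n) (Fin p) ℝ) (j : Fin p) : ℝ :=
  ‖WithLp.toLp 2 (M.col j)‖

/-- The Euclidean inner product `M_jᵀ M_k` of the columns `j` and `k` of a matrix. -/
def colInner {n p : ℕ} (M : Matrix (Fin n) (Fin p) ℝ) (j k : Fin p) : ℝ :=
  dotProduct (M.col j) (M.col k)

/-!
Write `X_u = ‖V u‖²` for a unit vector `u`. By polarization the inner product of the columns `j`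
and `k` is `(X_u - X_w) / 2` with `u, w = (e_j ± e_k) / √2` (`colInner_eq_polarization`), and the
squared column norms are themselves `X_{e_j}` and `X_{e_k}`. Hence everything follows from one
concentration bound, `|X_u - n / p| < (n / p) δ` outside an event of probability at most
`2 exp (-n δ² / 16)`, applied with `δ = 4 n ^ (-1 / 4)` to the two vectors `u, w` for the first
claim, and to all four vectors for the second one
(`IsUniformStiefel.measureReal_two_sided_le`).

The concentration bound is Chernoff's method, with the exponential moment taken along a Gaussian
vector. Since the law of `V` is invariant under the orthogonal group, the law of `X_u` does not
depend on `u`, so that by homogeneity the event `0 ≤ r (X_u - a)` is at most as likely as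
`0 ≤ r (‖V g‖² - a ‖g‖²)`, for every vector `g`
(`IsUniformStiefel.measure_le_measure_homogeneous`). Bound the latter by Markov's inequality for
`exp (π r (‖V g‖² - a ‖g‖²))`, integrate over `g` against the probability density `exp (-π ‖g‖²)`
and exchange the integrals. For a fixed `V` with orthonormal rows the integral over `g` is Gaussian
in an orthonormal basis that extends the rows, and equals
`(1 + r a - r) ^ (-n / 2) * (1 + r a) ^ (-(p - n) / 2)` (`IsUniformStiefel.chernoff`). With
`a = (n / p) (1 + δ) < 1` and the optimal `r`, the inequality `log z ≤ z - 1` for the second factor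
leaves `((1 + δ) exp (-δ)) ^ (n / 2)`, whatever `p` is; `δ` of either sign is allowed, which gives
both tails (`IsUniformStiefel.measureReal_one_sided_le`). For `a ≥ 1` the probability is `0`, which
follows from the same bound as `r → ∞` (`IsUniformStiefel.measureReal_ge_le_of_one_le`).
-/

section

variable {Ω : Type*} [MeasurableSpace Ω] {P : Measure Ω} {n p : ℕ}
  {V : Ω → Matrix (Fin n) (Fin p) ℝ}

/-! ### The quadratic form `‖M g‖²` -/

/-- The squared Euclidean length `‖M g‖²` of the image of the vector `g` under the matrix `M`. -/
def mulVecNormSq {n p : ℕ} (M : Matrix (Fin n) (Fin p) ℝ) (g : Fin p → ℝ) : ℝ :=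
  ∑ i, (M.mulVec g) i ^ 2

lemma mulVecNormSq_smul {n p : ℕ} (M : Matrix (Fin n) (Fin p) ℝ) (c : ℝ) (g : Fin p → ℝ) :
    mulVecNormSq M (c • g) = c ^ 2 * mulVecNormSq M g := by
  simp [mulVecNormSq, Matrix.mulVec_smul, mul_pow, Finset.mul_sum]

lemma mulVecNormSq_mul {n p : ℕ} (M : Matrix (Fin n) (Fin p) ℝ) (O : Matrix (Fin p) (Fin p) ℝ)
    (g : Fin p → ℝ) : mulVecNormSq (M * O) g = mulVecNormSq M (O.mulVec g) := by
  simp [mulVecNormSq, Matrix.mulVec_mulVec]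

lemma continuous_mulVecNormSq {n p : ℕ} :
    Continuous fun x : Matrix (Fin n) (Fin p) ℝ × (Fin p → ℝ) => mulVecNormSq x.1 x.2 := by
  unfold mulVecNormSq
  fun_prop

/-- The rows of `M` are part of an orthonormal basis; in its coordinates `‖M g‖²` is the sum of the
squares of the first `n` coordinates. -/
lemma exists_orthonormalBasis_mulVecNormSq_eq {n m : ℕ} {M : Matrix (Fin n) (Fin (n + m)) ℝ}
    (hM : M ∈ stiefel n (n + m)) :
    ∃ b : OrthonormalBasis (Fin (n + m)) ℝ (EuclideanSpace ℝ (Fin (n + m))),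
      ∀ g : EuclideanSpace ℝ (Fin (n + m)),
        mulVecNormSq M g.ofLp = ∑ i : Fin n, b.repr g (Fin.castAdd m i) ^ 2 := by
  let v : Fin (n + m) → EuclideanSpace ℝ (Fin (n + m)) :=
    Fin.addCases (fun i => WithLp.toLp 2 (M i)) (fun _ => 0)
  have hv : Orthonormal ℝ ((Set.range (Fin.castAdd m : Fin n → Fin (n + m))).domRestrict v) := by
    rw [orthonormal_iff_ite]
    rintro ⟨_, i, rfl⟩ ⟨_, k, rfl⟩
    have h : (M * M.transpose) i k = (1 : Matrix (Fin n) (Fin n) ℝ) i k := by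
      rw [show M * M.transpose = 1 from hM]
    have hinner : inner ℝ (v (Fin.castAdd m i)) (v (Fin.castAdd m k)) = if i = k then 1 else 0 := by
      simpa [v, Matrix.mul_apply, Matrix.one_apply, EuclideanSpace.inner_eq_star_dotProduct,
        dotProduct, mul_comm] using h
    by_cases hik : i = k
    · subst hik
      simpa using hinner
    · rw [if_neg (by simpa [Subtype.ext_iff] using hik)]
      simpa [hik] using hinner
  obtain ⟨b, hb⟩ := hv.exists_orthonormalBasis_extension_of_card_eq (by simp)
  refine ⟨b, fun g => Finset.sum_congr rfl fun i _ => ?_⟩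
  rw [b.repr_apply_apply, hb _ ⟨i, rfl⟩]
  simp [v, Matrix.mulVec, EuclideanSpace.inner_eq_star_dotProduct, dotProduct, mul_comm]

lemma colNorm_sq (M : Matrix (Fin n) (Fin p) ℝ) (j : Fin p) :
    colNorm M j ^ 2 = mulVecNormSq M (EuclideanSpace.single j (1 : ℝ)).ofLp := by
  simp [colNorm, mulVecNormSq, EuclideanSpace.real_norm_sq_eq]

/-- Polarization: the inner product of two columns is half the difference of the values of
`‖M u‖²` at the unit vectors `(e_j ± e_k) / √2`. -/
lemma colInner_eq_polarization (M : Matrix (Fin n) (Fin p) ℝ) (j k : Fin p) :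
    colInner M j k = (mulVecNormSq M
        ((√2)⁻¹ • (EuclideanSpace.single j (1 : ℝ) + EuclideanSpace.single k 1)).ofLp
      - mulVecNormSq M
        ((√2)⁻¹ • (EuclideanSpace.single j (1 : ℝ) - EuclideanSpace.single k 1)).ofLp) / 2 := by
  rw [WithLp.ofLp_smul, WithLp.ofLp_smul, mulVecNormSq_smul, mulVecNormSq_smul, inv_pow,
    Real.sq_sqrt zero_le_two, ← mul_sub]
  simp only [mulVecNormSq, colInner, dotProduct, ← Finset.sum_sub_distrib, WithLp.ofLp_add,
    WithLp.ofLp_sub, PiLp.ofLp_single, Matrix.mulVec_add, Matrix.mulVec_sub,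
    Matrix.mulVec_single_one, Pi.add_apply, Pi.sub_apply, Finset.mul_sum, Finset.sum_div]
  exact Finset.sum_congr rfl fun i _ => by ring

lemma norm_inv_sqrt_two_smul_single_add {j k : Fin p} (hjk : j ≠ k) (s : ℝ) (hs : s ^ 2 = 1) :
    ‖(√2)⁻¹ • (EuclideanSpace.single j (1 : ℝ) + EuclideanSpace.single k s)‖ = 1 := by
  have h : ‖EuclideanSpace.single j (1 : ℝ) + EuclideanSpace.single k s‖ ^ 2 = 2 := by
    rw [norm_add_sq_real]
    simp [EuclideanSpace.inner_single_left, hjk, hs]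
    norm_num
  have h2 : ‖EuclideanSpace.single j (1 : ℝ) + EuclideanSpace.single k s‖ = √2 := by
    rw [← h, Real.sqrt_sq (norm_nonneg _)]
  rw [norm_smul, h2, norm_inv, Real.norm_of_nonneg (Real.sqrt_nonneg _)]
  exact inv_mul_cancel₀ (by positivity)

/-! ### Gaussian integrals -/

lemma lintegral_exp_neg_pi_sum_mul_sq {ι : Type*} [Fintype ι] (x : ι → ℝ) (hx : ∀ i, 0 < x i) :
    ∫⁻ g : EuclideanSpace ℝ ι, ENNReal.ofReal (Real.exp (-Real.pi * ∑ i, x i * g i ^ 2))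
      = ENNReal.ofReal (∏ i, (√(x i))⁻¹) := by
  have hsplit : ∀ g : ι → ℝ, Real.exp (-Real.pi * ∑ i, x i * g i ^ 2)
      = ∏ i, Real.exp (-(Real.pi * x i) * g i ^ 2) := fun g => by
    rw [← Real.exp_sum, Finset.mul_sum]
    congr 1
    exact Finset.sum_congr rfl fun i _ => by ring
  rw [(PiLp.volume_preserving_ofLp ι).lintegral_comp_emb
    (MeasurableEquiv.toLp 2 (ι → ℝ)).symm.measurableEmbedding
    (fun g => ENNReal.ofReal (Real.exp (-Real.pi * ∑ i, x i * g i ^ 2)))]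
  simp_rw [hsplit]
  rw [← ofReal_integral_eq_lintegral_ofReal]
  · rw [integral_fintype_prod_volume_eq_prod (fun i t => Real.exp (-(Real.pi * x i) * t ^ 2))]
    congr 1
    refine Finset.prod_congr rfl fun i _ => ?_
    rw [integral_gaussian, ← Real.sqrt_inv]
    congr 1
    field_simp
  · exact Integrable.fintype_prod (f := fun i t => Real.exp (-(Real.pi * x i) * t ^ 2))
      fun i => integrable_exp_neg_mul_sq (mul_pos Real.pi_pos (hx i))
  · exact Filter.Eventually.of_forall fun g => Finset.prod_nonneg fun i _ => (Real.exp_pos _).le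

/-- The Gaussian integral of the quadratic form `y ‖g‖² - r ‖M g‖²`, whose eigenvalues are `y - r`
with multiplicity `n` and `y` with multiplicity `m`. -/
lemma lintegral_gaussian_stiefel {n m : ℕ} {M : Matrix (Fin n) (Fin (n + m)) ℝ}
    (hM : M ∈ stiefel n (n + m)) {r y : ℝ} (hy : 0 < y) (hx : 0 < y - r) :
    ∫⁻ g : EuclideanSpace ℝ (Fin (n + m)),
        ENNReal.ofReal (Real.exp (-Real.pi * (y * ‖g‖ ^ 2 - r * mulVecNormSq M g.ofLp)))
      = ENNReal.ofReal ((√(y - r))⁻¹ ^ n * (√y)⁻¹ ^ m) := by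
  obtain ⟨b, hb⟩ := exists_orthonormalBasis_mulVecNormSq_eq hM
  let x : Fin (n + m) → ℝ := Fin.addCases (fun _ => y - r) (fun _ => y)
  have hpos : ∀ i, 0 < x i := fun i => by
    refine Fin.addCases (fun i => ?_) (fun i => ?_) i <;>
      simp only [x, Fin.addCases_left, Fin.addCases_right] <;> assumption
  have hform : ∀ g : EuclideanSpace ℝ (Fin (n + m)),
      y * ‖g‖ ^ 2 - r * mulVecNormSq M g.ofLp = ∑ i, x i * b.repr g i ^ 2 := fun g => by
    rw [hb, ← b.repr.norm_map, EuclideanSpace.real_norm_sq_eq, Fin.sum_univ_add, Fin.sum_univ_add]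
    simp only [x, Fin.addCases_left, Fin.addCases_right, ← Finset.mul_sum]
    ring
  simp_rw [hform]
  rw [b.measurePreserving_repr.lintegral_comp_emb
    b.repr.toHomeomorph.measurableEmbedding
    (fun g => ENNReal.ofReal (Real.exp (-Real.pi * ∑ i, x i * g i ^ 2))),
    lintegral_exp_neg_pi_sum_mul_sq x hpos, Fin.prod_univ_add]
  simp [x]

lemma continuous_gaussian_stiefel (r y : ℝ) :
    Continuous fun x : EuclideanSpace ℝ (Fin p) × Matrix (Fin n) (Fin p) ℝ =>
      ENNReal.ofReal (Real.exp (-Real.pi * (y * ‖x.1‖ ^ 2 - r * mulVecNormSq x.2 x.1.ofLp))) := by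
  have h : Continuous fun x : EuclideanSpace ℝ (Fin p) × Matrix (Fin n) (Fin p) ℝ =>
      mulVecNormSq x.2 x.1.ofLp :=
    continuous_mulVecNormSq.comp
      (continuous_snd.prodMk ((PiLp.continuous_ofLp 2 _).comp continuous_fst))
  exact ENNReal.continuous_ofReal.comp (Real.continuous_exp.comp (continuous_const.mul
    ((continuous_const.mul (continuous_fst.norm.pow 2)).sub (continuous_const.mul h))))

instance matrixSecondCountableTopology :
    SecondCountableTopology (Matrix (Fin n) (Fin p) ℝ) :=
  inferInstanceAs (SecondCountableTopology (Fin n → Fin p → ℝ))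

lemma measurable_gaussian_stiefel (r y : ℝ) :
    Measurable fun x : EuclideanSpace ℝ (Fin p) × Matrix (Fin n) (Fin p) ℝ =>
      ENNReal.ofReal (Real.exp (-Real.pi * (y * ‖x.1‖ ^ 2 - r * mulVecNormSq x.2 x.1.ofLp))) :=
  (continuous_gaussian_stiefel r y).measurable

/-! ### Orthogonal invariance -/

/-- The orthogonal group acts transitively on the unit sphere. -/
lemma exists_orthogonal_mulVec_single {p : ℕ} (j : Fin p) (u : EuclideanSpace ℝ (Fin p))
    (hu : ‖u‖ = 1) :
    ∃ O ∈ Matrix.orthogonalGroup (Fin p) ℝ, O.mulVec (Pi.single j 1) = u.ofLp := by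
  have hv : Orthonormal ℝ (({j} : Set (Fin p)).domRestrict fun _ => u) := by
    rw [orthonormal_iff_ite]
    rintro ⟨_, rfl⟩ ⟨_, rfl⟩
    simp [hu]
  obtain ⟨b, hb⟩ := hv.exists_orthonormalBasis_extension_of_card_eq (by simp)
  refine ⟨_, (EuclideanSpace.basisFun (Fin p) ℝ).toMatrix_orthonormalBasis_mem_orthogonal b, ?_⟩
  ext i
  simp [Module.Basis.toMatrix_apply, hb j rfl]

/-- The law of `‖V u‖²` is the same for all unit vectors `u`. -/
lemma IsUniformStiefel.identDistrib_mulVecNormSq (hV : IsUniformStiefel V P)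
    {u v : EuclideanSpace ℝ (Fin p)} (hu : ‖u‖ = 1) (hv : ‖v‖ = 1) :
    IdentDistrib (fun ω => mulVecNormSq (V ω) u.ofLp) (fun ω => mulVecNormSq (V ω) v.ofLp) P P := by
  obtain ⟨j⟩ : Nonempty (Fin p) := by
    by_contra h
    rw [not_nonempty_iff] at h
    simp [Subsingleton.elim u 0] at hu
  have key : ∀ w : EuclideanSpace ℝ (Fin p), ‖w‖ = 1 →
      IdentDistrib (fun ω => mulVecNormSq (V ω) (Pi.single j 1))
        (fun ω => mulVecNormSq (V ω) w.ofLp) P P := fun w hw => by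
    obtain ⟨O, hO, hOw⟩ := exists_orthogonal_mulVec_single j w hw
    have hmeas : Measurable fun M : Matrix (Fin n) (Fin p) ℝ => mulVecNormSq M (Pi.single j 1) :=
      (continuous_mulVecNormSq.comp (Continuous.prodMk_left _)).measurable
    have h := (hV.identDistrib_mul O hO).comp hmeas
    simpa only [Function.comp_def, mulVecNormSq_mul, hOw] using h
  exact (key u hu).symm.trans (key v hv)

/-- Homogeneity turns the event that `‖V u‖²` lies on one side of `a` into an event about an
arbitrary vector `g`; at `g = 0` that event is certain. -/
lemma IsUniformStiefel.measure_le_measure_homogeneous [IsProbabilityMeasure P]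
    (hV : IsUniformStiefel V P) {u : EuclideanSpace ℝ (Fin p)} (hu : ‖u‖ = 1) (r a : ℝ)
    (g : EuclideanSpace ℝ (Fin p)) :
    P {ω | 0 ≤ r * (mulVecNormSq (V ω) u.ofLp - a)}
      ≤ P {ω | 0 ≤ r * (mulVecNormSq (V ω) g.ofLp - a * ‖g‖ ^ 2)} := by
  by_cases hg : g = 0
  · subst hg
    have : {ω | 0 ≤ r * (mulVecNormSq (V ω) (0 : EuclideanSpace ℝ (Fin p)).ofLp
        - a * ‖(0 : EuclideanSpace ℝ (Fin p))‖ ^ 2)} = Set.univ := by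
      ext ω
      simp [mulVecNormSq]
    rw [this, measure_univ]
    exact prob_le_one
  · have hg' : 0 < ‖g‖ := norm_pos_iff.mpr hg
    have hunit : ‖(‖g‖⁻¹ : ℝ) • g‖ = 1 := by
      rw [norm_smul, norm_inv, norm_norm, inv_mul_cancel₀ hg'.ne']
    have hB : MeasurableSet {t : ℝ | 0 ≤ r * (t - a)} :=
      measurableSet_le measurable_const (by fun_prop)
    refine ((hV.identDistrib_mulVecNormSq hu hunit).measure_mem_eq hB).le.trans
      (measure_mono fun ω hω => ?_)
    simp only [Set.preimage_ofPred_eq, Set.mem_ofPred_eq, WithLp.ofLp_smul,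
      mulVecNormSq_smul] at hω ⊢
    have h := mul_nonneg (sq_nonneg ‖g‖) hω
    have : ‖g‖ ^ 2 * (r * ((‖g‖⁻¹) ^ 2 * mulVecNormSq (V ω) g.ofLp - a))
        = r * (mulVecNormSq (V ω) g.ofLp - a * ‖g‖ ^ 2) := by
      field_simp
    rwa [this] at h

/-! ### Concentration of `‖V u‖²` -/

/-- Chernoff's bound for `‖V u‖²`: the exponential moment is taken along a Gaussian vector `g`
independent of `V`, for which it is an explicit product. The tail is the upper one for `0 < r` and
the lower one for `r < 0`. -/
lemma IsUniformStiefel.chernoff {m : ℕ} {V : Ω → Matrix (Fin n) (Fin (n + m)) ℝ}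
    [IsProbabilityMeasure P] (hV : IsUniformStiefel V P) {u : EuclideanSpace ℝ (Fin (n + m))}
    (hu : ‖u‖ = 1) {r a : ℝ} (hy : 0 < 1 + r * a) (hx : 0 < 1 + r * a - r) :
    P.real {ω | 0 ≤ r * (mulVecNormSq (V ω) u.ofLp - a)}
      ≤ (√(1 + r * a - r))⁻¹ ^ n * (√(1 + r * a))⁻¹ ^ m := by
  have hVm : AEMeasurable V P := by
    simpa using (hV.identDistrib_mul 1 (one_mem _)).aemeasurable_fst
  set F : EuclideanSpace ℝ (Fin (n + m)) → Matrix (Fin n) (Fin (n + m)) ℝ → ENNReal := fun g M =>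
    ENNReal.ofReal
      (Real.exp (-Real.pi * ((1 + r * a) * ‖g‖ ^ 2 - r * mulVecNormSq M g.ofLp)))
  -- The standard density `exp (-π ‖g‖²)`, written with unit weights, has total mass `1`.
  have hq : ∫⁻ g : EuclideanSpace ℝ (Fin (n + m)),
      ENNReal.ofReal (Real.exp (-Real.pi * ∑ i, 1 * g i ^ 2)) = 1 := by
    rw [lintegral_exp_neg_pi_sum_mul_sq (fun _ => 1) fun _ => one_pos]
    simp
  -- Markov's inequality at a fixed `g`, multiplied by the density at `g`.
  have hpoint : ∀ g : EuclideanSpace ℝ (Fin (n + m)),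
      ENNReal.ofReal (Real.exp (-Real.pi * ∑ i, 1 * g i ^ 2))
        * P {ω | 0 ≤ r * (mulVecNormSq (V ω) u.ofLp - a)} ≤ ∫⁻ ω, F g (V ω) ∂P := fun g => by
    refine (mul_le_mul_right (hV.measure_le_measure_homogeneous hu r a g) _).trans ?_
    have hFm : AEMeasurable (fun ω => F g (V ω)) P := by
      have h : AEMeasurable (fun ω => (g, V ω)) P := aemeasurable_const.prodMk hVm
      have h2 := (measurable_gaussian_stiefel r (1 + r * a)).comp_aemeasurable h
      exact h2
    refine (mul_le_mul_right (measure_mono fun ω hω => ?_) _).trans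
      (mul_meas_ge_le_lintegral₀ hFm _)
    refine ENNReal.ofReal_le_ofReal (Real.exp_le_exp.mpr ?_)
    simp only [Set.mem_ofPred_eq] at hω
    have hn : ∑ i, 1 * g i ^ 2 = ‖g‖ ^ 2 := by simp [EuclideanSpace.real_norm_sq_eq]
    rw [hn]
    nlinarith [mul_nonneg Real.pi_pos.le hω]
  have hswap : ∫⁻ g, (∫⁻ ω, F g (V ω) ∂P) = ∫⁻ ω, (∫⁻ g, F g (V ω)) ∂P := by
    refine lintegral_lintegral_swap ?_
    have h : AEMeasurable
        (fun x : EuclideanSpace ℝ (Fin (n + m)) × Ω => (x.1, V x.2)) (volume.prod P) :=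
      measurable_fst.aemeasurable.prodMk hVm.comp_snd
    have h2 := (measurable_gaussian_stiefel r (1 + r * a)).comp_aemeasurable h
    exact h2
  have hbound : P {ω | 0 ≤ r * (mulVecNormSq (V ω) u.ofLp - a)}
      ≤ ENNReal.ofReal ((√(1 + r * a - r))⁻¹ ^ n * (√(1 + r * a))⁻¹ ^ m) := by
    calc _ = ∫⁻ g : EuclideanSpace ℝ (Fin (n + m)),
          ENNReal.ofReal (Real.exp (-Real.pi * ∑ i, 1 * g i ^ 2))
            * P {ω | 0 ≤ r * (mulVecNormSq (V ω) u.ofLp - a)} := by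
          rw [lintegral_mul_const' _ _ (measure_ne_top _ _), hq, one_mul]
      _ ≤ ∫⁻ g, (∫⁻ ω, F g (V ω) ∂P) := lintegral_mono hpoint
      _ = ∫⁻ ω, (∫⁻ g, F g (V ω)) ∂P := hswap
      _ = ∫⁻ _, ENNReal.ofReal ((√(1 + r * a - r))⁻¹ ^ n * (√(1 + r * a))⁻¹ ^ m) ∂P := by
          refine lintegral_congr_ae ?_
          filter_upwards [hV.mem_stiefel] with ω hω
          exact lintegral_gaussian_stiefel hω hy hx
      _ = _ := by simp
  exact ENNReal.toReal_le_of_le_ofReal (by positivity) hbound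

/-- A second-order form of `1 + δ ≤ exp δ`; the quadratic gain is what makes the tails of
`‖V u‖²` decay. -/
lemma one_add_le_exp_sub_sq_div {δ : ℝ} (h : |δ| ≤ 1 / 2) : 1 + δ ≤ Real.exp (δ - δ ^ 2 / 8) := by
  obtain ⟨h1, h2⟩ := abs_le.mp h
  rcases le_total 0 δ with h0 | h0
  · have hu : 0 ≤ δ - δ ^ 2 / 8 := by nlinarith
    have hexp := Real.quadratic_le_exp_of_nonneg hu
    nlinarith [mul_nonneg h0 h0, mul_nonneg (mul_nonneg h0 h0) h0,
      mul_nonneg (mul_nonneg h0 h0) (sub_nonneg.2 h2), sq_nonneg (δ ^ 2)]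
  · obtain ⟨t, rfl⟩ : ∃ t, δ = -t := ⟨-δ, by ring⟩
    have ht : 0 ≤ t := by linarith
    have hu : 0 ≤ t + t ^ 2 / 8 := by positivity
    have hexp := Real.exp_bound' hu (by nlinarith) (n := 2) two_pos
    norm_num [Finset.sum_range_succ] at hexp
    rw [show -t - (-t) ^ 2 / 8 = -(t + t ^ 2 / 8) by ring, Real.exp_neg, le_inv_comm₀ (by linarith)
      (Real.exp_pos _)]
    refine hexp.trans ?_
    rw [← one_div, le_div_iff₀ (by linarith)]
    have h3 : 0 ≤ t ^ 3 := by positivity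
    have h4 : t ^ 4 ≤ t ^ 3 := by nlinarith
    have h5 : 0 ≤ t ^ 5 := by positivity
    nlinarith [sq_nonneg t]

/-- If the threshold is at least `1`, the exponential moment tends to `0` as `r → ∞`, since some
direction is orthogonal to the rows of `V`. -/
lemma IsUniformStiefel.measureReal_ge_le_of_one_le {m : ℕ}
    {V : Ω → Matrix (Fin n) (Fin (n + m)) ℝ} [IsProbabilityMeasure P] (hV : IsUniformStiefel V P)
    (hm : m ≠ 0) {u : EuclideanSpace ℝ (Fin (n + m))} (hu : ‖u‖ = 1) {a : ℝ} (ha : 1 ≤ a) (B : ℝ) :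
    P.real {ω | a ≤ mulVecNormSq (V ω) u.ofLp} ≤ Real.exp (-B) := by
  have hr : 0 < Real.exp (2 * B) := Real.exp_pos _
  have hra : Real.exp (2 * B) ≤ Real.exp (2 * B) * a := le_mul_of_one_le_right hr.le ha
  have hx : 1 ≤ √(1 + Real.exp (2 * B) * a - Real.exp (2 * B)) := Real.one_le_sqrt.2 (by linarith)
  have hy1 : 1 ≤ √(1 + Real.exp (2 * B) * a) := Real.one_le_sqrt.2 (by linarith)
  have hy : Real.exp B ≤ √(1 + Real.exp (2 * B) * a) := by
    refine Real.le_sqrt_of_sq_le ?_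
    rw [← Real.exp_nat_mul]
    push_cast
    linarith
  calc P.real {ω | a ≤ mulVecNormSq (V ω) u.ofLp}
      ≤ P.real {ω | 0 ≤ Real.exp (2 * B) * (mulVecNormSq (V ω) u.ofLp - a)} :=
        measureReal_mono fun ω hω => mul_nonneg hr.le (sub_nonneg.2 hω)
    _ ≤ _ := hV.chernoff hu (by linarith) (by linarith)
    _ ≤ 1 * (√(1 + Real.exp (2 * B) * a))⁻¹ := by
        refine mul_le_mul (pow_le_one₀ (by positivity) (inv_le_one_of_one_le₀ hx)) ?_
          (by positivity) zero_le_one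
        exact pow_le_of_le_one (by positivity) (inv_le_one_of_one_le₀ hy1) hm
    _ ≤ Real.exp (-B) := by
        rw [one_mul, Real.exp_neg]
        exact inv_anti₀ (Real.exp_pos _) hy

/-- Both one-sided tails of `‖V u‖²` around its mean `n / (n + m)`: the upper one for `0 < δ` and
the lower one for `δ < 0`. -/
lemma IsUniformStiefel.measureReal_one_sided_le {m : ℕ} {V : Ω → Matrix (Fin n) (Fin (n + m)) ℝ}
    [IsProbabilityMeasure P] (hV : IsUniformStiefel V P) (hn : n ≠ 0) (hm : m ≠ 0)
    {u : EuclideanSpace ℝ (Fin (n + m))} (hu : ‖u‖ = 1) {δ : ℝ} (h0 : δ ≠ 0) (hδ : |δ| ≤ 1 / 2) :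
    P.real {ω | 0 ≤ δ * (mulVecNormSq (V ω) u.ofLp - n / (n + m) * (1 + δ))}
      ≤ Real.exp (-(n * δ ^ 2 / 16)) := by
  obtain ⟨h1, h2⟩ := abs_le.mp hδ
  have hn' : (0 : ℝ) < n := by positivity
  have hm' : (0 : ℝ) < m := by positivity
  by_cases ha : 1 ≤ n / (n + m) * (1 + δ)
  · have hpos : 0 < δ := by
      by_contra hneg
      have : (n : ℝ) / (n + m) < 1 := (div_lt_one (by linarith)).2 (by linarith)
      have : (0 : ℝ) < n / (n + m) := by positivity
      nlinarith
    -- Here the optimal slope is not available, and any `B` may be used.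
    refine le_trans (measureReal_mono fun ω hω => ?_) (hV.measureReal_ge_le_of_one_le hm hu ha _)
    exact sub_nonneg.1 (nonneg_of_mul_nonneg_right hω hpos)
  · have hlt : n * δ < m := by
      rw [not_le, div_mul_eq_mul_div, div_lt_one (by linarith)] at ha
      linarith
    have hd : 0 < 1 + δ := by linarith
    have hz : 0 < 1 - n * δ / m := by
      rw [sub_pos, div_lt_one hm']
      exact hlt
    obtain ⟨D, hD⟩ : ∃ D : ℝ, D = m - n * δ := ⟨_, rfl⟩
    have hD0 : 0 < D := by linarith
    have hDm : 1 - n * δ / m = D / m := by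
      rw [hD]
      field_simp
    -- The optimal slope `r = δ * κ`, for which the two factors are simple.
    set κ : ℝ := (n + m) / ((1 + δ) * D) with hκ
    have hκ0 : 0 < κ := by positivity
    have hy : 1 + δ * κ * (n / (n + m) * (1 + δ)) = (1 - n * δ / m)⁻¹ := by
      rw [hκ, hDm]
      field_simp
      linarith
    have hx : 1 + δ * κ * (n / (n + m) * (1 + δ)) - δ * κ = (1 + δ)⁻¹ := by
      rw [hκ]
      field_simp
      linear_combination δ * hD
    have hchernoff := hV.chernoff (r := δ * κ) (a := n / (n + m) * (1 + δ)) hu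
      (by rw [hy]; exact inv_pos.2 hz) (by rw [hx]; exact inv_pos.2 hd)
    rw [hx, hy, Real.sqrt_inv, Real.sqrt_inv, inv_inv, inv_inv] at hchernoff
    have hsub : {ω | 0 ≤ δ * (mulVecNormSq (V ω) u.ofLp - n / (n + m) * (1 + δ))}
        ⊆ {ω | 0 ≤ δ * κ * (mulVecNormSq (V ω) u.ofLp - n / (n + m) * (1 + δ))} := fun ω hω => by
      have := mul_nonneg hκ0.le hω
      simp only [Set.mem_ofPred_eq]
      linarith
    have hfac1 : √(1 + δ) ^ n ≤ Real.exp (n * ((δ - δ ^ 2 / 8) / 2)) := by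
      rw [Real.exp_nat_mul, Real.exp_half]
      exact pow_le_pow_left₀ (Real.sqrt_nonneg _)
        (Real.sqrt_le_sqrt (one_add_le_exp_sub_sq_div hδ)) n
    -- A linear bound is enough here: its product with the linear part of `hfac1` is `1`.
    have hfac2 : √(1 - n * δ / m) ^ m ≤ Real.exp (m * (-(n * δ / m) / 2)) := by
      rw [Real.exp_nat_mul, Real.exp_half]
      exact pow_le_pow_left₀ (Real.sqrt_nonneg _)
        (Real.sqrt_le_sqrt (Real.one_sub_le_exp_neg _)) m
    calc _ ≤ _ := measureReal_mono hsub
      _ ≤ _ := hchernoff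
      _ ≤ _ := mul_le_mul hfac1 hfac2 (by positivity) (by positivity)
      _ = Real.exp (-(n * δ ^ 2 / 16)) := by
        rw [← Real.exp_add]
        congr 1
        field_simp
        ring

/-- Two-sided concentration of `‖V u‖²` around its mean `n / p`. -/
lemma IsUniformStiefel.measureReal_two_sided_le [IsProbabilityMeasure P]
    (hV : IsUniformStiefel V P) (hn : n ≠ 0) (hp : n < p)
    {u : EuclideanSpace ℝ (Fin p)} (hu : ‖u‖ = 1) {δ : ℝ} (h0 : 0 < δ) (hδ : δ ≤ 1 / 2) :
    P.real {ω | n / p * δ ≤ |mulVecNormSq (V ω) u.ofLp - n / p|}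
      ≤ 2 * Real.exp (-(n * δ ^ 2 / 16)) := by
  obtain ⟨m, rfl⟩ := Nat.exists_eq_add_of_le hp.le
  have hm : m ≠ 0 := by omega
  have hup := hV.measureReal_one_sided_le hn hm hu h0.ne' (by rwa [abs_of_pos h0])
  have hlo := hV.measureReal_one_sided_le hn hm hu (neg_ne_zero.2 h0.ne')
    (by rwa [abs_neg, abs_of_pos h0])
  rw [neg_sq] at hlo
  rw [two_mul]
  refine (measureReal_mono fun ω hω => ?_).trans
    ((measureReal_union_le _ _).trans (add_le_add hup hlo))
  simp only [Set.mem_union, Set.mem_ofPred_eq] at hω ⊢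
  push_cast at hω
  rcases le_abs.1 hω with h | h
  · exact Or.inl (mul_nonneg h0.le (by linarith))
  · exact Or.inr (mul_nonneg_of_nonpos_of_nonpos (by linarith) (by linarith))

end

/-! ### Inner products of columns -/

theorem mainTheorem6 :
    ∃ c₁ c₂ : ℝ, 0 < c₁ ∧ 0 < c₂ ∧ ∃ N : ℕ, ∀ n p : ℕ, N ≤ n → n < p →
      ∀ (Ω : Type*) [MeasurableSpace Ω] (P : Measure Ω) [IsProbabilityMeasure P]
        (V : Ω → Matrix (Fin n) (Fin p) ℝ), IsUniformStiefel V P →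
      ∀ j k : Fin p, j ≠ k →
        P.real {ω | |colInner (V ω) j k| ≥ 2 * c₁ * (n : ℝ) ^ (3 / 4 : ℝ) / (p : ℝ)}
            ≤ 6 * Real.exp (-√(n : ℝ)) ∧
        P.real {ω | |colInner (V ω) j k| / (colNorm (V ω) j * colNorm (V ω) k)
              ≥ c₂ * (n : ℝ) ^ (-1 / 4 : ℝ)}
            ≤ 8 * Real.exp (-√(n : ℝ)) := by
  refine ⟨2, 8, two_pos, by norm_num, 4096, fun n p hn hp Ω _ P _ V hV j k hjk => ?_⟩
  have hn0 : (0 : ℝ) < n := by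
    have : 0 < n := by omega
    exact_mod_cast this
  have hp0 : (0 : ℝ) < p := hn0.trans (by exact_mod_cast hp)
  -- The relative deviation at which the tail bound `2 * exp (-n * δ ^ 2 / 16)` is `2 * exp (-√n)`.
  set δ : ℝ := 4 * (n : ℝ) ^ (-1 / 4 : ℝ) with hδ
  have hδ0 : 0 < δ := by positivity
  have hδ1 : δ ≤ 1 / 2 := by
    have h : (n : ℝ) ^ (-1 / 4 : ℝ) ≤ (4096 : ℝ) ^ (-1 / 4 : ℝ) :=
      Real.rpow_le_rpow_of_nonpos (by norm_num) (by exact_mod_cast hn) (by norm_num)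
    have h' : (4096 : ℝ) ^ (-1 / 4 : ℝ) = 1 / 8 := by
      rw [show (4096 : ℝ) = 8 ^ (4 : ℝ) by norm_num, ← Real.rpow_mul (by norm_num)]
      norm_num [Real.rpow_neg_one]
    rw [hδ]
    linarith
  have hexp : n * δ ^ 2 / 16 = √n := by
    have h : (n : ℝ) ^ (1 / 2 : ℝ) = n * (n : ℝ) ^ (-1 / 2 : ℝ) := by
      rw [← Real.rpow_one_add' hn0.le (by norm_num)]
      norm_num
    rw [hδ, mul_pow, ← Real.rpow_mul_natCast hn0.le, Real.sqrt_eq_rpow, h]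
    norm_num
    ring
  -- With `c₁ = 2` the threshold of the first claim is the absolute deviation `(n / p) * δ`.
  have hthr : 2 * 2 * (n : ℝ) ^ (3 / 4 : ℝ) / p = n / p * δ := by
    have h : (n : ℝ) ^ (3 / 4 : ℝ) = n * (n : ℝ) ^ (-1 / 4 : ℝ) := by
      rw [← Real.rpow_one_add' hn0.le (by norm_num)]
      norm_num
    rw [h, hδ]
    ring
  set θ : ℝ := n / p with hθ
  have hθ0 : 0 < θ := by positivity
  -- The event that `‖V u‖²` deviates from `θ`; four of them are used, each of probability at most
  -- `2 * exp (-√n)`.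
  let bad : EuclideanSpace ℝ (Fin p) → Set Ω := fun u =>
    {ω | θ * δ ≤ |mulVecNormSq (V ω) u.ofLp - θ|}
  have hbad : ∀ u, ‖u‖ = 1 → P.real (bad u) ≤ 2 * Real.exp (-√n) := fun u hu => by
    have h := hV.measureReal_two_sided_le (by omega) hp hu hδ0 hδ1
    rwa [hexp] at h
  set a := (√2)⁻¹ • (EuclideanSpace.single j (1 : ℝ) + EuclideanSpace.single k 1) with ha
  set b := (√2)⁻¹ • (EuclideanSpace.single j (1 : ℝ) - EuclideanSpace.single k 1) with hb
  have hA := hbad a (norm_inv_sqrt_two_smul_single_add hjk 1 (by norm_num))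
  have hB := hbad b (by
    rw [hb, sub_eq_add_neg, ← PiLp.single_neg]
    exact norm_inv_sqrt_two_smul_single_add hjk (-1) (by norm_num))
  have hJ := hbad (EuclideanSpace.single j 1) (by simp)
  have hK := hbad (EuclideanSpace.single k 1) (by simp)
  have hgood : ∀ u ω, ω ∉ bad u → |mulVecNormSq (V ω) u.ofLp - θ| < θ * δ :=
    fun u ω h => lt_of_not_ge h
  have hinner : ∀ ω, ω ∉ bad a → ω ∉ bad b → |colInner (V ω) j k| < θ * δ := fun ω h1 h2 => by
    have h1 := abs_lt.1 (hgood _ _ h1)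
    have h2 := abs_lt.1 (hgood _ _ h2)
    rw [colInner_eq_polarization, abs_lt]
    constructor <;> linarith
  have hnorm : ∀ (i : Fin p) (ω : Ω), ω ∉ bad (EuclideanSpace.single i 1) →
      √(θ / 2) ≤ colNorm (V ω) i := fun i ω h => by
    have h := abs_lt.1 (hgood _ _ h)
    rw [← colNorm_sq] at h
    refine Real.sqrt_le_iff.2 ⟨norm_nonneg _, ?_⟩
    nlinarith
  have hAB : P.real (bad a ∪ bad b) ≤ 4 * Real.exp (-√n) :=
    (measureReal_union_le _ _).trans (by linarith)
  constructor
  · rw [hthr]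
    refine (measureReal_mono fun ω hω => ?_).trans (hAB.trans (by linarith [Real.exp_pos (-√n)]))
    by_contra h
    rw [Set.mem_union, not_or] at h
    exact absurd hω (not_le.2 (hinner ω h.1 h.2))
  · refine (measureReal_mono fun ω hω => ?_).trans ((measureReal_union_le (bad a ∪ bad b)
      (bad (EuclideanSpace.single j 1) ∪ bad (EuclideanSpace.single k 1))).trans
      ((add_le_add hAB (measureReal_union_le _ _)).trans (by linarith)))
    by_contra h
    simp only [Set.mem_union, not_or] at h
    have h1 := hinner ω h.1.1 h.1.2
    have h2 : θ / 2 ≤ colNorm (V ω) j * colNorm (V ω) k := by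
      rw [← Real.mul_self_sqrt (show 0 ≤ θ / 2 by positivity)]
      exact mul_le_mul (hnorm j ω h.2.1) (hnorm k ω h.2.2) (Real.sqrt_nonneg _) (norm_nonneg _)
    have hω : 8 * (n : ℝ) ^ (-1 / 4 : ℝ)
      ≤ |colInner (V ω) j k| / (colNorm (V ω) j * colNorm (V ω) k) := hω
    rw [le_div_iff₀ (by linarith)] at hω
    nlinarith
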